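/- Let $\mathcal{A}$ be a complex Banach algebra with unit $1$. An element $a\in\mathcal{A}$ is Drazin invertible if there is $b\in\mathcal{A}$ with $ab=ba$, $bab=b$ and $(a(1-ab))^n=0$ for some integer $n\ge 1$; such a $b$ is unique, it is denoted $a^d$, and the least such $n\ge 1$ is denoted $i(a)$. Let $x_1,x_2\in\mathcal{A}$ satisfy $x_1x_2=0$. (i) If $x_1$ and $x_2$ are Drazin invertible, then $x_1+x_2$ is Drazin invertible and $$(x_1+x_2)^d=\sum_{n=1}^{i(x_2)}(1-x_2x_2^d)\,x_2^{n-1}(x_1^d)^n+\sum_{n=1}^{i(x_1)}(x_2^d)^n x_1^{n-1}(1-x_1x_1^d),$$ where $a^0=1$. (ii) If $x_1+x_2$ is Drazin invertible and at least one of $x_1$, $x_2$ is Drazin invertible, then both $x_1$ and $x_2$ are Drazin invertible, and $$x_2^d=(x_1+x_2)^d-\left((x_1+x_2)^d\right)^2x_1.$$ -/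

import Mathlib

/-- `b` is a Drazin inverse of `a`: `ab = ba`, `bab = b`, and `(a(1 - ab))^n = 0` for some
positive integer `n`. -/
structure IsDrazinInverse {A : Type*} [Ring A] (a b : A) : Prop where
  comm : a * b = b * a
  outer : b * a * b = b
  nilpotent : ∃ n : ℕ, 1 ≤ n ∧ (a * (1 - a * b)) ^ n = 0

/-- `a` is Drazin invertible. -/
def IsDrazinInvertible {A : Type*} [Ring A] (a : A) : Prop :=
  ∃ b : A, IsDrazinInverse a b

theorem IsDrazinInverse.exists_pow {A : Type*} [Ring A] {a b : A} (h : IsDrazinInverse a b) :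
    Commute a b ∧ (a * b) * (a * b) = a * b ∧
      ∃ n : ℕ, ∀ k : ℕ, n ≤ k → a ^ k * (a * b) = a ^ k := by
  have hc : Commute a b := h.comm
  have hid : (a * b) * (a * b) = a * b := by
    rw [← mul_assoc, mul_assoc a b a, mul_assoc a (b * a) b, h.outer]
  obtain ⟨n, hn, h0⟩ := h.nilpotent
  have hid' : IsIdempotentElem (1 - a * b) := IsIdempotentElem.one_sub hid
  have hc' : Commute a (1 - a * b) :=
    (Commute.one_right a).sub_right ((Commute.refl a).mul_right hc)
  rw [hc'.mul_pow, hid'.pow_eq (by omega), mul_sub, mul_one, sub_eq_zero] at h0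
  refine ⟨hc, hid, n, fun k hk => ?_⟩
  obtain ⟨j, rfl⟩ := Nat.exists_eq_add_of_le' hk
  rw [pow_add, mul_assoc, ← h0]

/-- The Drazin inverse is unique. -/
theorem IsDrazinInverse.unique {A : Type*} [Ring A] {a b c : A}
    (hb : IsDrazinInverse a b) (hc : IsDrazinInverse a c) : b = c := by
  obtain ⟨cb, ib, m, hm⟩ := hb.exists_pow
  obtain ⟨cc, ic, n, hn⟩ := hc.exists_pow
  have hm := hm (m + n + 1) (by omega)
  have hn := hn (m + n + 1) (by omega)
  have pb : (a * b) ^ (m + n + 1) = a * b :=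
    IsIdempotentElem.pow_eq ib (by omega)
  have pc : (a * c) ^ (m + n + 1) = a * c :=
    IsIdempotentElem.pow_eq ic (by omega)
  rw [cb.mul_pow] at pb
  rw [cc.mul_pow] at pc
  have e1 : (a * b) * (a * c) = a * b := by
    rw [← pb, (cb.pow_pow _ _).eq, mul_assoc, hn]
  have hm' : (a * b) * a ^ (m + n + 1) = a ^ (m + n + 1) := by
    rw [← ((Commute.refl a).mul_right cb).pow_left (m + n + 1) |>.eq, hm]
  have e2 : (a * b) * (a * c) = a * c := by
    rw [← pc, ← mul_assoc, hm']
  have e : a * b = a * c := e1.symm.trans e2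
  calc b = b * a * b := hb.outer.symm
    _ = b * (a * c) := by rw [mul_assoc, e]
    _ = (a * b) * c := by rw [← mul_assoc, hb.comm]
    _ = c * a * c := by rw [e, hc.comm]
    _ = c := hc.outer

open Classical in
/-- The Drazin inverse `a^d` of a Drazin invertible element `a` (and `0` otherwise). -/
noncomputable def drazinInv {A : Type*} [Ring A] (a : A) : A :=
  if h : IsDrazinInvertible a then h.choose else 0

theorem IsDrazinInvertible.drazinInv_spec {A : Type*} [Ring A] {a : A}
    (h : IsDrazinInvertible a) : IsDrazinInverse a (drazinInv a) := by
  rw [drazinInv, dif_pos h]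
  exact h.choose_spec

theorem IsDrazinInverse.drazinInv_eq {A : Type*} [Ring A] {a b : A}
    (h : IsDrazinInverse a b) : drazinInv a = b :=
  IsDrazinInverse.unique (IsDrazinInvertible.drazinInv_spec ⟨b, h⟩) h

/-- The Drazin index `i(a)` of a Drazin invertible element `a`: the smallest positive integer `n`
with `(a(1 - a a^d))^n = 0`. -/
noncomputable def drazinIndex {A : Type*} [Ring A] (a : A) : ℕ :=
  sInf {n : ℕ | 1 ≤ n ∧ (a * (1 - a * drazinInv a)) ^ n = 0}

/-! Work in Laurent series over `A` with `T` central. An element `a` is Drazin invertible iff `T -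
a` is a unit, and then `(T - a)⁻¹ = ∑ aⁿ(1 - a aᵈ) T⁻ⁿ⁻¹ - ∑ (aᵈ)ⁿ⁺¹ Tⁿ` over `n ≥ 0`, whose
principal part is finite by nilpotency; `-aᵈ` is the constant coefficient
(`IsDrazinInverse.exists_resolvent`, `isDrazinInverse_neg_coeff_zero`). If `x y = 0`, then `(T -
x)(T - y) = T (T - (x + y))` with `T` a unit. Invertibility thus passes between the three factors,
and both formulas come from comparing coefficients. -/

open HahnSeries

/-- The Laurent series `T - a`. -/
noncomputable def linearSeries {A : Type*} [Ring A] (a : A) : HahnSeries ℤ A :=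
  single 1 1 - single 0 a

theorem coeff_linearSeries_mul {A : Type*} [Ring A] (a : A) (u : HahnSeries ℤ A) (k : ℤ) :
    (linearSeries a * u).coeff k = u.coeff (k - 1) - a * u.coeff k := by
  rw [linearSeries, sub_mul, coeff_sub, coeff_single_mul, one_mul, coeff_single_zero_mul]

theorem coeff_mul_linearSeries {A : Type*} [Ring A] (a : A) (u : HahnSeries ℤ A) (k : ℤ) :
    (u * linearSeries a).coeff k = u.coeff (k - 1) - u.coeff k * a := by
  rw [linearSeries, mul_sub, coeff_sub, coeff_mul_single, mul_one, coeff_mul_single_zero]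

theorem single_one_mul_comm {A : Type*} [Ring A] (u : HahnSeries ℤ A) (k : ℤ) :
    single k (1 : A) * u = u * single k 1 := by
  ext j
  rw [coeff_single_mul, coeff_mul_single, one_mul, mul_one]

theorem isUnit_single_one {A : Type*} [Ring A] : IsUnit (single (1 : ℤ) (1 : A)) :=
  ⟨⟨single 1 1, single (-1) 1, by simp [single_mul_single], by simp [single_mul_single]⟩, rfl⟩

theorem linearSeries_mul_linearSeries {A : Type*} [Ring A] {x y : A} (h : x * y = 0) :
    linearSeries x * linearSeries y = single 1 1 * linearSeries (x + y) := by
  simp only [linearSeries, single_add, mul_add, mul_sub, sub_mul, single_mul_single, h, one_mul,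
    mul_one, add_zero, zero_add, map_zero, sub_zero]
  abel

/-- The Laurent expansion of the resolvent of a Drazin invertible element. -/
theorem IsDrazinInverse.exists_resolvent {A : Type*} [Ring A] {a b : A}
    (h : IsDrazinInverse a b) :
    ∃ u : (HahnSeries ℤ A)ˣ, (u : HahnSeries ℤ A) = linearSeries a ∧
      (∀ n : ℕ, (↑u⁻¹ : HahnSeries ℤ A).coeff n = -b ^ (n + 1)) ∧
      ∀ n : ℕ, (↑u⁻¹ : HahnSeries ℤ A).coeff (Int.negSucc n) = a ^ n * (1 - a * b) := by
  obtain ⟨hc, -, N, hN⟩ := h.exists_pow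
  have hb (n : ℕ) : a * b ^ (n + 2) = b ^ (n + 1) := by
    rw [pow_succ' b (n + 1), pow_succ' b n, ← mul_assoc, ← mul_assoc, hc.eq, h.outer]
  -- `Int.negSucc n` is the exponent `-(n + 1)`, so the second case is the principal part.
  let f : ℤ → A
    | Int.ofNat n => -b ^ (n + 1)
    | Int.negSucc n => a ^ n * (1 - a * b)
  have hf : BddBelow (Function.support f) := by
    refine ⟨-N, fun k hk => ?_⟩
    by_contra hlt
    obtain ⟨n, rfl⟩ : ∃ n : ℕ, k = Int.negSucc n := ⟨(-k - 1).toNat, by omega⟩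
    refine hk ?_
    change a ^ n * (1 - a * b) = 0
    rw [mul_sub, mul_one, hN n (by omega), sub_self]
  have hL (k : ℤ) : f (k - 1) - a * f k = (1 : HahnSeries ℤ A).coeff k := by
    rcases k with (_ | n) | n
    · change a ^ 0 * (1 - a * b) - a * -b ^ (0 + 1) = _
      simp
    · have e : (Int.ofNat (n + 1) - 1 : ℤ) = Int.ofNat n := by simp
      rw [e, coeff_one, if_neg (by simp; omega)]
      change -b ^ (n + 1) - a * -b ^ (n + 2) = 0
      rw [mul_neg, hb, sub_self]
    · rw [coeff_one, if_neg (by simp)]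
      change a ^ (n + 1) * (1 - a * b) - a * (a ^ n * (1 - a * b)) = 0
      rw [pow_succ', mul_assoc, sub_self]
  have hcomm (k : ℤ) : Commute a (f k) := by
    rcases k with n | n
    · exact (hc.pow_right _).neg_right
    · exact ((Commute.refl a).pow_right n).mul_right
        ((Commute.one_right a).sub_right ((Commute.refl a).mul_right hc))
  refine ⟨⟨linearSeries a, ofSuppBddBelow f hf, ?_, ?_⟩, rfl, fun _ => rfl, fun _ => rfl⟩
  · ext k
    rw [coeff_linearSeries_mul, coeff_ofSuppBddBelow, hL]
  · ext k
    rw [coeff_mul_linearSeries, coeff_ofSuppBddBelow, ← (hcomm k).eq, hL]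

/-- If `T - a` is invertible as a Laurent series, then `a` is Drazin invertible, and its inverse
is read off from the constant coefficient. -/
theorem isDrazinInverse_neg_coeff_zero {A : Type*} [Ring A] {a : A} (u : (HahnSeries ℤ A)ˣ)
    (hu : (u : HahnSeries ℤ A) = linearSeries a) :
    IsDrazinInverse a (-(↑u⁻¹ : HahnSeries ℤ A).coeff 0) := by
  set v : HahnSeries ℤ A := ↑u⁻¹ with hv
  have hL (k : ℤ) : v.coeff (k - 1) - a * v.coeff k = (1 : HahnSeries ℤ A).coeff k := by
    rw [← coeff_linearSeries_mul, ← hu, u.mul_inv]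
  have hR (k : ℤ) : v.coeff (k - 1) - v.coeff k * a = (1 : HahnSeries ℤ A).coeff k := by
    rw [← coeff_mul_linearSeries, ← hu, u.inv_mul]
  -- The left and right recursions share the term `v.coeff (k - 1)`.
  have hcomm (k : ℤ) : Commute a (v.coeff k) :=
    sub_right_injective ((hL k).trans (hR k).symm)
  have h1 : v.coeff (-1) = 1 + a * v.coeff 0 := by
    have := hL 0
    rw [coeff_one, if_pos rfl, zero_sub] at this
    rw [← this, sub_add_cancel]
  have hstep (k : ℤ) (hk : k ≠ 0) : v.coeff (k - 1) = a * v.coeff k := by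
    have := hL k
    rwa [coeff_one, if_neg hk, sub_eq_zero] at this
  have hneg (n : ℕ) : v.coeff (-1 - n) = a ^ n * v.coeff (-1) := by
    induction n with
    | zero => simp
    | succ n ih =>
      rw [pow_succ', mul_assoc, ← ih, ← hstep _ (by omega)]
      congr 1
      push_cast
      ring
  have hpos (n : ℕ) : v.coeff 0 = a ^ n * v.coeff n := by
    induction n with
    | zero => simp
    | succ n ih =>
      rw [pow_succ, mul_assoc, ← hstep _ (by omega), ih]
      congr 2
      push_cast
      ring
  -- `a ^ N * v.coeff (-1)` is the coefficient at `-1 - N`, which lies below the order of `v` for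
  -- large `N`.
  obtain ⟨N, hN⟩ : ∃ N : ℕ, 1 ≤ N ∧ a ^ N * v.coeff (-1) = 0 := by
    refine ⟨(-v.order).toNat + 1, by omega, ?_⟩
    rw [← hneg]
    exact coeff_eq_zero_of_lt_order (by omega)
  have h1' : 1 - a * -v.coeff 0 = v.coeff (-1) := by rw [h1, mul_neg, sub_neg_eq_add]
  have h0 : v.coeff 0 * v.coeff (-1) = 0 := by
    rw [hpos N, ((hcomm N).pow_left N).eq, mul_assoc, hN.2, mul_zero]
  refine ⟨(hcomm 0).neg_right, ?_, N, hN.1, ?_⟩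
  · rw [h1, mul_add, mul_one, ← mul_assoc] at h0
    rw [neg_mul, neg_mul_neg, eq_neg_of_add_eq_zero_right h0]
  · obtain ⟨m, rfl⟩ : ∃ m, N = m + 1 := ⟨N - 1, by omega⟩
    rw [h1', (hcomm (-1)).mul_pow, pow_succ' (v.coeff (-1)), ← mul_assoc, hN.2, zero_mul]

theorem isDrazinInvertible_iff_isUnit_linearSeries {A : Type*} [Ring A] {a : A} :
    IsDrazinInvertible a ↔ IsUnit (linearSeries a) :=
  ⟨fun ⟨_, h⟩ => let ⟨u, hu, _⟩ := h.exists_resolvent; ⟨u, hu⟩,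
    fun ⟨u, hu⟩ => ⟨_, isDrazinInverse_neg_coeff_zero u hu⟩⟩

theorem IsDrazinInvertible.pow_mul_one_sub_eq_zero {A : Type*} [Ring A] {a : A}
    (h : IsDrazinInvertible a) {n : ℕ} (hn : drazinIndex a ≤ n) :
    a ^ n * (1 - a * drazinInv a) = 0 := by
  obtain ⟨hc, hid, -⟩ := h.drazinInv_spec.exists_pow
  obtain ⟨h1, h0⟩ : drazinIndex a ∈ {n : ℕ | 1 ≤ n ∧ (a * (1 - a * drazinInv a)) ^ n = 0} :=
    Nat.sInf_mem h.drazinInv_spec.nilpotent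
  have hc' : Commute a (1 - a * drazinInv a) :=
    (Commute.one_right a).sub_right ((Commute.refl a).mul_right hc)
  rw [hc'.mul_pow, (IsIdempotentElem.one_sub hid).pow_eq (by omega)] at h0
  obtain ⟨j, rfl⟩ := Nat.exists_eq_add_of_le' hn
  rw [_root_.pow_add, mul_assoc, h0, mul_zero]

/-- The coefficient of `T⁻¹` in a product of Laurent series with poles of bounded orders. -/
theorem coeff_mul_neg_one {A : Type*} [Ring A] (u v : HahnSeries ℤ A) {M N : ℕ}
    (hu : ∀ n : ℕ, M ≤ n → u.coeff (Int.negSucc n) = 0)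
    (hv : ∀ n : ℕ, N ≤ n → v.coeff (Int.negSucc n) = 0) :
    (u * v).coeff (-1) =
      ∑ n ∈ Finset.range M, u.coeff (Int.negSucc n) * v.coeff n +
        ∑ n ∈ Finset.range N, u.coeff n * v.coeff (Int.negSucc n) := by
  classical
  -- Of two integers with sum `-1`, exactly one is negative.
  let p : ℕ → ℤ × ℤ := fun n => (Int.negSucc n, n)
  let q : ℕ → ℤ × ℤ := fun n => (n, Int.negSucc n)
  have hp : Function.Injective p := fun m n h => by simpa [p] using h
  have hq : Function.Injective q := fun m n h => by simpa [q] using h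
  have hd : Disjoint ((Finset.range M).image p) ((Finset.range N).image q) := by
    rw [Finset.disjoint_left]
    rintro _ h h'
    obtain ⟨m, -, rfl⟩ := Finset.mem_image.1 h
    obtain ⟨n, -, h⟩ := Finset.mem_image.1 h'
    simp [p, q] at h
  rw [← Finset.sum_image (f := fun ij : ℤ × ℤ => u.coeff ij.1 * v.coeff ij.2) hp.injOn,
    ← Finset.sum_image (f := fun ij : ℤ × ℤ => u.coeff ij.1 * v.coeff ij.2) hq.injOn,
    ← Finset.sum_union hd, coeff_mul]
  refine Finset.sum_congr_of_eq_on_inter ?_ ?_ fun _ _ _ => rfl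
  · rintro ⟨i, j⟩ h h'
    obtain ⟨-, -, hij⟩ := Finset.mem_antidiagonal.1 h
    simp only [Finset.mem_union, Finset.mem_image, not_or, not_exists, not_and,
      Finset.mem_range] at h' hij
    rcases i with m | m
    · obtain rfl : j = Int.negSucc m := by rw [Int.ofNat_eq_natCast] at hij; omega
      have : N ≤ m := not_lt.1 fun hm => h'.2 m hm rfl
      rw [hv m this, mul_zero]
    · obtain rfl : j = (m : ℤ) := by omega
      have : M ≤ m := not_lt.1 fun hm => h'.1 m hm rfl
      rw [hu m this, zero_mul]
  · rintro ⟨i, j⟩ h h'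
    have hij : i + j = -1 := by
      simp only [Finset.mem_union, Finset.mem_image, p, q, Prod.mk.injEq] at h
      rcases h with ⟨n, -, rfl, rfl⟩ | ⟨n, -, rfl, rfl⟩ <;> omega
    by_contra hne
    exact h' (Finset.mem_antidiagonal.2
      ⟨fun h0 => hne (by rw [h0, zero_mul]), fun h0 => hne (by rw [h0, mul_zero]), hij⟩)

theorem IsDrazinInvertible.isDrazinInverse_add {A : Type*} [Ring A] {x y : A} (h : x * y = 0)
    (hx : IsDrazinInvertible x) (hy : IsDrazinInvertible y) :
    IsDrazinInverse (x + y)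
      (∑ n ∈ Finset.range (drazinIndex y),
          y ^ n * (1 - y * drazinInv y) * drazinInv x ^ (n + 1) +
        ∑ n ∈ Finset.range (drazinIndex x),
          drazinInv y ^ (n + 1) * (x ^ n * (1 - x * drazinInv x))) := by
  obtain ⟨u, hu, hu0, hu1⟩ := hx.drazinInv_spec.exists_resolvent
  obtain ⟨v, hv, hv0, hv1⟩ := hy.drazinInv_spec.exists_resolvent
  obtain ⟨t, ht⟩ := isUnit_single_one (A := A)
  have e := linearSeries_mul_linearSeries h
  rw [← hu, ← hv, ← ht] at e
  have hw : ((t⁻¹ * (u * v) : (HahnSeries ℤ A)ˣ) : HahnSeries ℤ A) = linearSeries (x + y) := by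
    rw [Units.val_mul, Units.val_mul, e, Units.inv_mul_cancel_left]
  have := isDrazinInverse_neg_coeff_zero _ hw
  -- The inverse is `(T - y)⁻¹ (T - x)⁻¹ T`; the factor `T` turns its constant coefficient into the
  -- `T⁻¹` coefficient of the product of resolvents.
  rw [mul_inv_rev, mul_inv_rev, inv_inv, Units.val_mul, Units.val_mul, ht, coeff_mul_single,
    zero_sub, mul_one, coeff_mul_neg_one (M := drazinIndex y) (N := drazinIndex x) _ _
      (fun n hn => by rw [hv1, hy.pow_mul_one_sub_eq_zero hn])
      (fun n hn => by rw [hu1, hx.pow_mul_one_sub_eq_zero hn])] at this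
  simpa only [hu0, hu1, hv0, hv1, neg_add, mul_neg, neg_mul, Finset.sum_neg_distrib, neg_neg]
    using this

/-- If a product and one of its factors are units, so is the other factor. -/
theorem IsDrazinInvertible.of_add {A : Type*} [Ring A] {x y : A} (h : x * y = 0)
    (hs : IsDrazinInvertible (x + y)) (hxy : IsDrazinInvertible x ∨ IsDrazinInvertible y) :
    IsDrazinInvertible x ∧ IsDrazinInvertible y := by
  have hu : IsUnit (linearSeries x * linearSeries y) := by
    rw [linearSeries_mul_linearSeries h]
    exact isUnit_single_one.mul (isDrazinInvertible_iff_isUnit_linearSeries.1 hs)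
  simp only [isDrazinInvertible_iff_isUnit_linearSeries] at *
  rcases hxy with hx | hy
  · obtain ⟨u, hx'⟩ := hx
    rw [← hx', Units.isUnit_units_mul] at hu
    exact ⟨⟨u, hx'⟩, hu⟩
  · obtain ⟨u, hy'⟩ := hy
    rw [← hy', Units.isUnit_mul_units] at hu
    exact ⟨hu, ⟨u, hy'⟩⟩

theorem IsDrazinInvertible.isDrazinInverse_right {A : Type*} [Ring A] {x y : A} (h : x * y = 0)
    (hs : IsDrazinInvertible (x + y)) (hy : IsDrazinInvertible y) :
    IsDrazinInverse y (drazinInv (x + y) - drazinInv (x + y) ^ 2 * x) := by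
  obtain ⟨u, hu, hu0, -⟩ := hs.drazinInv_spec.exists_resolvent
  obtain ⟨v, hv⟩ := isDrazinInvertible_iff_isUnit_linearSeries.1 hy
  have e := linearSeries_mul_linearSeries h
  rw [← hu, ← hv] at e
  have key : (↑u⁻¹ : HahnSeries ℤ A) * linearSeries x = single 1 1 * (↑v⁻¹ : HahnSeries ℤ A) := by
    rw [Units.eq_mul_inv_iff_mul_eq, mul_assoc, e, single_one_mul_comm,
      Units.inv_mul_cancel_left]
  -- The coefficient of `T` on the right is the constant coefficient of `(T - y)⁻¹`.
  have hc := congrArg (fun w : HahnSeries ℤ A => w.coeff 1) key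
  simp only [coeff_mul_linearSeries, coeff_single_mul, sub_self, one_mul] at hc
  have := isDrazinInverse_neg_coeff_zero v hv
  rw [← hc] at this
  have e0 := hu0 0
  have e1 := hu0 1
  simp only [Nat.cast_zero, Nat.cast_one, zero_add, pow_one] at e0 e1
  rw [e0, e1] at this
  convert this using 1
  noncomm_ring

theorem corollary4p2 {A : Type*} [NormedRing A] [NormedAlgebra ℂ A] [CompleteSpace A]
    (x₁ x₂ : A) (h : x₁ * x₂ = 0) :
    (IsDrazinInvertible x₁ → IsDrazinInvertible x₂ →
      IsDrazinInvertible (x₁ + x₂) ∧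
      drazinInv (x₁ + x₂) =
        ∑ n ∈ Finset.Icc 1 (drazinIndex x₂),
            (1 - x₂ * drazinInv x₂) * x₂ ^ (n - 1) * drazinInv x₁ ^ n +
          ∑ n ∈ Finset.Icc 1 (drazinIndex x₁),
            drazinInv x₂ ^ n * x₁ ^ (n - 1) * (1 - x₁ * drazinInv x₁)) ∧
    (IsDrazinInvertible (x₁ + x₂) → IsDrazinInvertible x₁ ∨ IsDrazinInvertible x₂ →
      IsDrazinInvertible x₁ ∧ IsDrazinInvertible x₂ ∧
      drazinInv x₂ = drazinInv (x₁ + x₂) - drazinInv (x₁ + x₂) ^ 2 * x₁) := by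
  refine ⟨fun hx hy => ?_, fun hs hxy => ?_⟩
  · have H := hx.isDrazinInverse_add h hy
    refine ⟨⟨_, H⟩, ?_⟩
    have hc : Commute x₂ (1 - x₂ * drazinInv x₂) :=
      (Commute.one_right _).sub_right
        ((Commute.refl _).mul_right hy.drazinInv_spec.comm)
    rw [H.drazinInv_eq, ← Finset.Ico_add_one_right_eq_Icc, ← Finset.Ico_add_one_right_eq_Icc,
      Finset.sum_Ico_eq_sum_range, Finset.sum_Ico_eq_sum_range]
    simp only [Nat.add_sub_cancel, add_comm 1, mul_assoc,
      fun n : ℕ => (hc.pow_left n).left_comm]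
  · obtain ⟨hx, hy⟩ := hs.of_add h hxy
    exact ⟨hx, hy, (hs.isDrazinInverse_right h hy).drazinInv_eq⟩
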